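/- **Model.** Let $\alpha,\beta>2$, $\nu>1$, $\theta,\sigma^2,z_m,z_s>0$, $q\ge 0$, $0<\varepsilon,\delta<1$ and $K\in\{0,1,2,\dots\}$. For base-station density $\lambda_b>0$, the base stations are the typical one $Y_0=0$ together with the points $Y_1,Y_2,\dots$ of a homogeneous Poisson point process in $\mathbb R^2$ with density $\lambda_b$. Given the base stations, the active mobiles $U_n$ ($n\ge 0$) are independent, and $U_n$ is uniformly distributed in the Voronoi cell of $Y_n$. The power beacons form a homogeneous Poisson point process $\Psi$ with density $\lambda_p>0$, independent of the base stations and mobiles. Mobiles transmit with power $p>0$ and beacons with power $q$. The interference from the $K$ interfering mobiles $U_n$ ($n\ge1$) nearest to $Y_0$ is cancelled; let $\mathcal C$ be the set of their labels. The outage probability of $Y_0$ is $$P_{\mathsf{out}}(\lambda_b,p)=\Pr\left(\frac{p|U_0|^{-\alpha}}{\sum_{n\ge 1,\,n\notin\mathcal C}p|U_n|^{-\alpha}+\sigma^2}<\theta\right).$$ The raw power received by a mobile at $U$ is $$P_U=q\sum_{T\in\Psi}\max(|T-U|,\nu)^{-\beta}$$ for isotropic microwave power transfer (MPT), and $$P_U=z_mq\max(|T_0-U|,\nu)^{-\beta}+z_sq\sum_{T\in\Psi\setminus\{T_0\}}\max(|T-U|,\nu)^{-\beta}$$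 for directed MPT, where $T_0$ is the beacon nearest to $U$. For mobiles with small energy storage, and for given $q$, the feasibility region $\mathcal F_h$ is the set of all $(\lambda_b,\lambda_p)$ with $\lambda_b,\lambda_p>0$ for which there is a transmission power $p>0$ such that $P_{\mathsf{out}}(\lambda_b,p)\le\varepsilon$ and $\Pr(P_{U_n}<p)\le\delta$ for every active mobile $U_n$. Finally, let $\mu>0$ be such that for $\lambda_b=1$ $$\Pr\left(\sum_{n\ge1,\,n\notin\mathcal C}|U_n|^{-\alpha}-\theta^{-1}|U_0|^{-\alpha}+\mu>0\right)=\varepsilon .$$ **Proposition.** 1) For isotropic MPT, $$\left\{(\lambda_b,\lambda_p)\in[0,\infty)^2 : q^{\frac2\beta}\lambda_p\lambda_b^{\frac\alpha\beta}\ge\frac{\log\frac1\delta}{\pi}\left(\frac{\sigma^2}{\mu}\right)^{\frac2\beta},\ q^{\frac2\alpha}\lambda_b\ge\left(\frac{\sigma^2\nu^\beta}{\mu}\right)^{\frac2\alpha}\right\}\subseteq\mathcal F_h .$$ 2) For directed MPT, $$\left\{(\lambda_b,\lambda_p)\in[0,\infty)^2 : (z_mq)^{\frac2\beta}\lambda_p\lambda_b^{\frac\alpha\beta}\ge\frac{\log\frac1\delta}{\pi}\left(\frac{\sigma^2}{\mu}\right)^{\frac2\beta},\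 (z_mq)^{\frac2\alpha}\lambda_b\ge\left(\frac{\sigma^2\nu^\beta}{\mu}\right)^{\frac2\alpha}\right\}\subseteq\mathcal F_h .$$ -/

import Mathlib

open MeasureTheory ProbabilityTheory Set
open scoped ENNReal NNReal

noncomputable section

namespace MPT

/-- The Euclidean plane. -/
abbrev Plane : Type := EuclideanSpace ℝ (Fin 2)

/-- Number of points of the configuration `S` in the set `B`. -/
def count (S B : Set Plane) : ℕ∞ := (S ∩ B).encard

/-- `Φ` is a homogeneous Poisson point process in the plane with density `lam`: the numbers of
points in Borel sets are random variables, the number of points in a set of finite area `a` is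
Poisson distributed with mean `lam * a`, and the numbers of points in finitely many pairwise
disjoint sets are independent. -/
structure IsPoissonProcess {Ω : Type*} [MeasurableSpace Ω] (P : Measure Ω) (lam : ℝ)
    (Φ : Ω → Set Plane) : Prop where
  measurable_count : ∀ B : Set Plane, MeasurableSet B → Measurable fun ω => count (Φ ω) B
  law_count : ∀ B : Set Plane, MeasurableSet B → volume B ≠ ∞ →
    P.map (fun ω => count (Φ ω) B) =
      (poissonMeasure (lam * (volume B).toReal).toNNReal).map (fun k : ℕ => (k : ℕ∞))
  indep_count : ∀ (n : ℕ) (B : Fin n → Set Plane), (∀ i, MeasurableSet (B i)) →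
    Pairwise (fun i j => Disjoint (B i) (B j)) →
    iIndepFun (fun i ω => count (Φ ω) (B i)) P

/-- The σ-algebra generated by a point process, that is, by all its counts. -/
abbrev pointSigma {Ω : Type*} (Φ : Ω → Set Plane) : MeasurableSpace Ω :=
  ⨆ B : {B : Set Plane // MeasurableSet B},
    MeasurableSpace.comap (fun ω => count (Φ ω) B) inferInstance

/-- The (closed) Voronoi cell of the `n`-th nucleus `y n`. -/
def voronoiCell (y : ℕ → Plane) (n : ℕ) : Set Plane :=
  {x | ∀ m, dist x (y n) ≤ dist x (y m)}

/-- Uplink cellular network with base-station density `lamB`, seen from the typical base station.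
`Y 0` is the typical base station, at the origin; the other base stations `Y 1, Y 2, …` form a
Poisson process of density `lamB` and are labelled by increasing distance from the origin.
`U n` is the active mobile served by `Y n`. Given all base stations, the active mobiles
are independent and each is uniformly distributed in the Voronoi cell of its base station. -/
structure IsCellularNetwork {Ω : Type*} [MeasurableSpace Ω] (P : Measure Ω) (lamB : ℝ)
    (Y U : ℕ → Ω → Plane) : Prop where
  measurable_bs : ∀ n, Measurable (Y n)
  measurable_mobile : ∀ n, Measurable (U n)
  typical_bs : ∀ ω, Y 0 ω = 0
  poisson_bs : IsPoissonProcess P lamB (fun ω => range fun n => Y (n + 1) ω)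
  ordered_bs : ∀ᵐ ω ∂P, StrictMono fun n => ‖Y n ω‖
  uniform_mobile : ∀ (S : Set (ℕ → Plane)), MeasurableSet S →
    ∀ (F : Finset ℕ) (A : ℕ → Set Plane), (∀ n, MeasurableSet (A n)) →
      P {ω | (fun n => Y n ω) ∈ S ∧ ∀ n ∈ F, U n ω ∈ A n} =
        ∫⁻ ω in {ω | (fun n => Y n ω) ∈ S},
          ∏ n ∈ F, (volume[|voronoiCell (fun m => Y m ω) n]) (A n) ∂P

/-- Hybrid network, as a function of its densities. For every base-station density `lamB > 0`,
`Y lamB` and `U lamB` are a cellular network of that density; for every power-beacon density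
`lamP > 0`, `Ψ lamP` is a Poisson process of that density; and the power beacons are independent
of the base stations and mobiles. -/
structure IsHybridNetwork {Ω : Type*} [MeasurableSpace Ω] (P : Measure Ω)
    (Y U : ℝ → ℕ → Ω → Plane) (Ψ : ℝ → Ω → Set Plane) : Prop where
  cellular : ∀ lamB : ℝ, 0 < lamB → IsCellularNetwork P lamB (Y lamB) (U lamB)
  poisson_pb : ∀ lamP : ℝ, 0 < lamP → IsPoissonProcess P lamP (Ψ lamP)
  indep_pb : ∀ lamB lamP : ℝ, 0 < lamB → 0 < lamP →
    Indep (pointSigma (Ψ lamP))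
      (MeasurableSpace.comap (fun ω n => (Y lamB n ω, U lamB n ω)) inferInstance) P

/-- Labels of the base stations whose mobiles are the `K` nearest interfering mobiles of the
typical base station at the origin, for active mobiles at `u 0, u 1, …`
(almost surely, no two mobiles are at the same distance). -/
def cancelled (K : ℕ) (u : ℕ → Plane) : Set ℕ :=
  {n | n ≠ 0 ∧ {m | m ≠ 0 ∧ ‖u m‖ < ‖u n‖}.encard < K}

open Classical in
/-- Interference at the typical base station, mobiles transmitting with power `p`. -/
def interference (α p : ℝ) (K : ℕ) (u : ℕ → Plane) : ℝ≥0∞ :=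
  ∑' n, if n ≠ 0 ∧ n ∉ cancelled K u then ENNReal.ofReal p * ‖u n‖ₑ ^ (-α) else 0

/-- Outage probability of the typical base station: the probability that the
signal-to-interference-and-noise ratio is below `θ`, where `σ ^ 2` is the noise variance. -/
def outageProb {Ω : Type*} [MeasurableSpace Ω] (P : Measure Ω) (U : ℕ → Ω → Plane)
    (α θ σ p : ℝ) (K : ℕ) : ℝ≥0∞ :=
  P {ω | ENNReal.ofReal p * ‖U 0 ω‖ₑ ^ (-α) /
      (interference α p K (fun n => U n ω) + ENNReal.ofReal (σ ^ 2)) < ENNReal.ofReal θ}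

/-- The probability that
`∑ [|U_Y| ^ (-α) 1{Y ≠ Y₀, Y ∉ C} - θ⁻¹ |U₀| ^ (-α) 1{Y = Y₀}] + μ` is positive. -/
def exceedProb {Ω : Type*} [MeasurableSpace Ω] (P : Measure Ω) (U : ℕ → Ω → Plane)
    (α θ μ : ℝ) (K : ℕ) : ℝ≥0∞ :=
  P {ω | ENNReal.ofReal θ⁻¹ * ‖U 0 ω‖ₑ ^ (-α) <
      interference α 1 K (fun n => U n ω) + ENNReal.ofReal μ}

/-- Power received over distance `dist T u` from a power beacon at `T` radiating unit power. -/
def pathGain (β ν : ℝ) (u T : Plane) : ℝ≥0∞ :=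
  ENNReal.ofReal (max (dist T u) ν ^ (-β))

/-- Raw power received at `u` from power beacons at `S` under isotropic transfer with power `q`. -/
def isotropicPower (β ν q : ℝ) (S : Set Plane) (u : Plane) : ℝ≥0∞ :=
  ENNReal.ofReal q * ∑' T : S, pathGain β ν u T

/-- A point of `S` nearest to `u` (one exists if `S` is non-empty and locally finite; the
received power below does not depend on the choice). -/
def nearestPoint (S : Set Plane) (u : Plane) : Plane :=
  Classical.epsilon fun T => T ∈ S ∧ ∀ T' ∈ S, dist T u ≤ dist T' u

/-- Raw power received at `u` from power beacons at `S` under directed transfer: the nearest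
beacon points its main lobe (gain `zm`) at `u`, from all the others `u` receives the side lobe
(gain `zs`). -/
def directedPower (β ν zm zs q : ℝ) (S : Set Plane) (u : Plane) : ℝ≥0∞ :=
  ENNReal.ofReal (zm * q) * pathGain β ν u (nearestPoint S u) +
    ENNReal.ofReal (zs * q) * ∑' T : ↥(S \ {nearestPoint S u}), pathGain β ν u T

/-- Feasibility region of the hybrid network for mobiles with small energy storage: the pairs
`(lamB, lamP)` of densities for which, for some transmission power `p > 0` of the mobiles,
the outage probability of the typical base station is at most `ε`, and for each active mobile the
received raw power is below the required power `p` with probability at most `δ`.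
`rx S u` is the raw power received at `u` from power beacons at `S`. -/
def feasibilityRegion {Ω : Type*} [MeasurableSpace Ω] (P : Measure Ω)
    (U : ℝ → ℕ → Ω → Plane) (Ψ : ℝ → Ω → Set Plane) (α θ σ : ℝ) (K : ℕ) (ε δ : ℝ)
    (rx : Set Plane → Plane → ℝ≥0∞) : Set (ℝ × ℝ) :=
  {x | 0 < x.1 ∧ 0 < x.2 ∧ ∃ p : ℝ, 0 < p ∧
    outageProb P (U x.1) α θ σ p K ≤ ENNReal.ofReal ε ∧
    ∀ n, P {ω | rx (Ψ x.2 ω) (U x.1 n ω) < ENNReal.ofReal p} ≤ ENNReal.ofReal δ}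

end MPT

end

/-! The proof combines a scaling argument for outage with a one-beacon bound for power transfer.
Dilating the plane by `√lamB` turns a cellular network of density `lamB` into one of density 1 and
multiplies every path loss by `lamB ^ (-α / 2)`. Dividing the outage inequality by the power shows
that outage at power `p` is the exceedance event of the dilated network with constant `σ ^ 2 / (p *
lamB ^ (α / 2))`. For `p = σ ^ 2 / (μ * lamB ^ (α / 2))` this constant is `μ`, so the outage
probability is exactly `ε` (`IsCellularNetwork.outageProb_eq_exceedProb`). Let `w` be `q` or `zm *
q`, and choose `r` with `w * r ^ (-β) = p`. If `ν ≤ r`, one beacon within distance `r` of a mobile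
suffices, so a shortage requires an empty disc, an event of probability at most `exp (-π * lamP * r
^ 2)`. The second inequality of the proposition says `ν ≤ r`; the first says that this bound is at
most `δ`. Two points need care: the dilated network and the given one of density 1 agree only in
law, so the axioms must be shown to determine the law of the mobiles
(`IsCellularNetwork.map_mobile_eq`); and the empty disc has a random centre
(`IsPoissonProcess.measure_closedBall_eq_empty_le`). -/

namespace MPT

/-! ### Void probabilities, for fixed and for independent random centres -/

section Void

variable {Ω : Type*} [MeasurableSpace Ω] {P : Measure Ω} {lam : ℝ} {Φ : Ω → Set Plane}

theorem count_eq_zero_iff {S B : Set Plane} : count S B = 0 ↔ S ∩ B = ∅ := by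
  simp [count]

/-- The void probabilities of a Poisson process. -/
theorem IsPoissonProcess.measure_count_eq_zero (h : IsPoissonProcess P lam Φ) (hlam : 0 ≤ lam)
    {B : Set Plane} (hB : MeasurableSet B) (hfin : volume B ≠ ∞) :
    P {ω | count (Φ ω) B = 0} = ENNReal.ofReal (Real.exp (-(lam * (volume B).toReal))) := by
  have h1 : {ω | count (Φ ω) B = 0} = (fun ω => count (Φ ω) B) ⁻¹' {0} := rfl
  have h2 : (fun k : ℕ => (k : ℕ∞)) ⁻¹' {0} = {0} := by ext; simp
  rw [h1, ← Measure.map_apply (h.measurable_count B hB) (measurableSet_singleton _),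
    h.law_count B hB hfin, Measure.map_apply measurable_from_top (measurableSet_singleton _), h2,
    poissonMeasure_singleton, Real.coe_toNNReal _ (by positivity)]
  simp

/-- A set of finite area almost surely contains finitely many points of a Poisson process. -/
theorem IsPoissonProcess.ae_count_ne_top (h : IsPoissonProcess P lam Φ)
    {B : Set Plane} (hB : MeasurableSet B) (hfin : volume B ≠ ∞) :
    ∀ᵐ ω ∂P, count (Φ ω) B ≠ ⊤ := by
  have h1 : {ω | ¬ count (Φ ω) B ≠ ⊤} = (fun ω => count (Φ ω) B) ⁻¹' {⊤} := by ext; simp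
  have h2 : (fun k : ℕ => (k : ℕ∞)) ⁻¹' {⊤} = ∅ := by ext; simp
  rw [ae_iff, h1, ← Measure.map_apply (h.measurable_count B hB) (measurableSet_singleton _),
    h.law_count B hB hfin, Measure.map_apply measurable_from_top (measurableSet_singleton _), h2,
    measure_empty]

/-- A Poisson process is almost surely locally finite. -/
theorem IsPoissonProcess.ae_finite_inter_closedBall (h : IsPoissonProcess P lam Φ) :
    ∀ᵐ ω ∂P, ∀ (x : Plane) (r : ℝ), (Φ ω ∩ Metric.closedBall x r).Finite := by
  have h1 : ∀ᵐ ω ∂P, ∀ n : ℕ, count (Φ ω) (Metric.closedBall 0 n) ≠ ⊤ :=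
    ae_all_iff.2 fun n => h.ae_count_ne_top measurableSet_closedBall
      Metric.isBounded_closedBall.measure_lt_top.ne
  filter_upwards [h1] with ω hω x r
  obtain ⟨n, hn⟩ := exists_nat_ge (r + dist x 0)
  exact (encard_ne_top_iff.1 (hω n)).subset
    (inter_subset_inter_right _ (Metric.closedBall_subset_closedBall' hn))

theorem measurable_count_pointSigma {Ω : Type*} {Φ : Ω → Set Plane} {B : Set Plane}
    (hB : MeasurableSet B) : Measurable[pointSigma Φ] fun ω => count (Φ ω) B :=
  Measurable.mono (comap_measurable fun ω => count (Φ ω) B)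
    (le_iSup (fun B : {B : Set Plane // MeasurableSet B} =>
      MeasurableSpace.comap (fun ω => count (Φ ω) B) inferInstance) ⟨B, hB⟩) le_rfl

/-- Discretise the centre: the plane splits into countably many pieces, each within `η` of a fixed
point `x j`. While `X` stays in one piece, the disc of radius `r + η` about `X` contains the fixed
disc of radius `r` about `x j`, to which independence applies. Only an upper bound is needed, so the
event on the left need not be measurable. -/
theorem IsPoissonProcess.measure_closedBall_approx [IsProbabilityMeasure P]
    (h : IsPoissonProcess P lam Φ) (hlam : 0 ≤ lam)
    {X : Ω → Plane} (hX : Measurable X)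
    (hind : Indep (pointSigma Φ) (MeasurableSpace.comap X inferInstance) P)
    {r η : ℝ} (hη : 0 < η) :
    P {ω | Φ ω ∩ Metric.closedBall (X ω) (r + η) = ∅} ≤
      ENNReal.ofReal (Real.exp (-(lam * (volume (Metric.closedBall (0 : Plane) r)).toReal))) := by
  set c := ENNReal.ofReal (Real.exp (-(lam * (volume (Metric.closedBall (0 : Plane) r)).toReal)))
  let x := TopologicalSpace.denseSeq Plane
  let D := disjointed fun j => Metric.ball (x j) η
  have hD : ∀ j, MeasurableSet (D j) := MeasurableSet.disjointed fun j => measurableSet_ball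
  have hcov : ⋃ j, D j = univ := by
    rw [iUnion_disjointed, eq_univ_iff_forall]
    intro y
    obtain ⟨j, hj⟩ := (TopologicalSpace.denseRange_denseSeq Plane).exists_dist_lt y hη
    exact mem_iUnion.2 ⟨j, hj⟩
  have hvol : ∀ y : Plane, volume (Metric.closedBall y r) =
      volume (Metric.closedBall (0 : Plane) r) := fun y => by
    simp [EuclideanSpace.volume_closedBall_fin_two]
  calc P {ω | Φ ω ∩ Metric.closedBall (X ω) (r + η) = ∅}
      ≤ P (⋃ j, {ω | count (Φ ω) (Metric.closedBall (x j) r) = 0} ∩ X ⁻¹' D j) := by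
        refine measure_mono fun ω hω => ?_
        obtain ⟨j, hj⟩ := mem_iUnion.1 (hcov.symm ▸ mem_univ (X ω))
        refine mem_iUnion.2 ⟨j, count_eq_zero_iff.2 ?_, hj⟩
        refine subset_empty_iff.1 (Subset.trans (inter_subset_inter_right _ ?_)
          (subset_empty_iff.2 hω))
        refine Metric.closedBall_subset_closedBall' ?_
        have := disjointed_subset _ _ hj
        rw [Metric.mem_ball'] at this
        linarith
    _ ≤ ∑' j, P ({ω | count (Φ ω) (Metric.closedBall (x j) r) = 0} ∩ X ⁻¹' D j) :=
        measure_iUnion_le _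
    _ = ∑' j, c * P (X ⁻¹' D j) := by
        refine tsum_congr fun j => ?_
        rw [(Indep_iff _ _ _).1 hind {ω | count (Φ ω) (Metric.closedBall (x j) r) = 0} _
          (measurable_count_pointSigma measurableSet_closedBall (measurableSet_singleton 0))
          ⟨D j, hD j, rfl⟩, h.measure_count_eq_zero hlam measurableSet_closedBall
            Metric.isBounded_closedBall.measure_lt_top.ne, hvol]
    _ = c * P (⋃ j, X ⁻¹' D j) := by
        rw [ENNReal.tsum_mul_left, measure_iUnion _ fun j => hX (hD j)]
        exact fun i j hij => (disjoint_disjointed _ hij).preimage X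
    _ = c := by rw [← preimage_iUnion, hcov, preimage_univ, measure_univ, mul_one]

/-- The void probability of a disc centred at a random point independent of the Poisson process. -/
theorem IsPoissonProcess.measure_closedBall_eq_empty_le [IsProbabilityMeasure P]
    (h : IsPoissonProcess P lam Φ) (hlam : 0 ≤ lam)
    {X : Ω → Plane} (hX : Measurable X)
    (hind : Indep (pointSigma Φ) (MeasurableSpace.comap X inferInstance) P)
    {r : ℝ} (hr : 0 < r) :
    P {ω | Φ ω ∩ Metric.closedBall (X ω) r = ∅} ≤
      ENNReal.ofReal (Real.exp (-(lam * (Real.pi * r ^ 2)))) := by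
  have hlim : Filter.Tendsto
      (fun s : ℝ => ENNReal.ofReal (Real.exp (-(lam * (Real.pi * s ^ 2))))) (nhdsWithin r (Iio r))
      (nhds (ENNReal.ofReal (Real.exp (-(lam * (Real.pi * r ^ 2)))))) := by
    refine (Continuous.tendsto ?_ r).mono_left nhdsWithin_le_nhds
    exact ENNReal.continuous_ofReal.comp (by fun_prop)
  refine ge_of_tendsto hlim ?_
  -- The approximation is used with inner radius `s < r` and slack `r - s`, so the empty disc keeps
  -- radius `r` as `s` increases to `r`.
  filter_upwards [Ioo_mem_nhdsLT hr] with s hs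
  have := h.measure_closedBall_approx hlam hX hind (r := s) (sub_pos.2 hs.2)
  rw [EuclideanSpace.volume_closedBall_fin_two, ENNReal.toReal_mul, ENNReal.toReal_pow,
    ENNReal.toReal_ofReal hs.1.le, ENNReal.toReal_ofReal Real.pi_pos.le, add_sub_cancel,
    mul_comm (s ^ 2)] at this
  exact this

end Void

/-! ### Uniqueness of the joint law of Poisson counts -/

section CountLaw

/-- The cell of the partition generated by the sets `B i` with membership pattern `b`. -/
def cell {ι : Type*} (B : ι → Set Plane) (b : ι → Prop) : Set Plane := {x | ∀ i, x ∈ B i ↔ b i}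

theorem pairwise_disjoint_cell {ι : Type*} (B : ι → Set Plane) :
    Pairwise fun b c => Disjoint (cell B b) (cell B c) := by
  intro b c hbc
  refine Set.disjoint_left.2 fun x hb hc => hbc ?_
  funext i
  exact propext ((hb i).symm.trans (hc i))

theorem measurableSet_cell {ι : Type*} [Countable ι] {B : ι → Set Plane}
    (hB : ∀ i, MeasurableSet (B i)) (b : ι → Prop) : MeasurableSet (cell B b) := by
  refine MeasurableSet.congr (MeasurableSet.iInter (f := fun i => {x | x ∈ B i ↔ b i}) fun i => ?_)
    (by ext; simp [cell])
  by_cases h : b i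
  · simpa [h] using hB i
  · simp only [h, iff_false]
    exact (hB i).compl

open Classical in
-- The pattern that is false everywhere is left out: its cell is the complement of all the `B i`,
-- which has infinite area. Every other cell lies in some `B i`.
theorem count_eq_sum_cell {ι : Type*} [Finite ι] [Fintype {b : ι → Prop // ∃ i, b i}]
    (B : ι → Set Plane) (S : Set Plane) (i : ι) :
    count S (B i) =
      ∑ b : {b : ι → Prop // ∃ i, b i}, if b.1 i then count S (cell B b) else 0 := by
  have h1 : S ∩ B i =
      ⋃ b : {b : ι → Prop // ∃ i, b i}, if b.1 i then S ∩ cell B b else ∅ := by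
    ext x
    simp only [mem_inter_iff, mem_iUnion]
    constructor
    · rintro ⟨hS, hx⟩
      refine ⟨⟨fun j => x ∈ B j, i, hx⟩, ?_⟩
      rw [if_pos hx]
      exact ⟨hS, fun j => Iff.rfl⟩
    · rintro ⟨b, hb⟩
      split_ifs at hb with h
      exacts [⟨hb.1, (hb.2 i).2 h⟩, hb.elim]
  rw [count, h1, encard_iUnion_of_finite, finsum_eq_sum_of_fintype]
  · refine Finset.sum_congr rfl fun b _ => ?_
    split_ifs
    exacts [rfl, encard_empty]
  · intro b c hbc
    have h := pairwise_disjoint_cell B (Subtype.coe_injective.ne hbc)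
    rw [Function.onFun]
    split_ifs
    exacts [h.mono inter_subset_right inter_subset_right, disjoint_bot_right, disjoint_bot_left,
      disjoint_bot_left]

variable {Ω Ω' : Type*} [MeasurableSpace Ω] [MeasurableSpace Ω'] {P : Measure Ω}
  {P' : Measure Ω'} [IsProbabilityMeasure P] [IsProbabilityMeasure P'] {lam : ℝ}
  {Φ : Ω → Set Plane} {Φ' : Ω' → Set Plane}

theorem IsPoissonProcess.map_count_of_disjoint (h : IsPoissonProcess P lam Φ) {ι : Type*}
    [Fintype ι] {B : ι → Set Plane} (hB : ∀ i, MeasurableSet (B i))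
    (hfin : ∀ i, volume (B i) ≠ ∞) (hd : Pairwise fun i j => Disjoint (B i) (B j)) :
    P.map (fun ω i => count (Φ ω) (B i)) = Measure.pi fun i =>
      (poissonMeasure (lam * (volume (B i)).toReal).toNNReal).map (fun k : ℕ => (k : ℕ∞)) := by
  let e := Fintype.equivFin ι
  have hi := h.indep_count (Fintype.card ι) (fun j => B (e.symm j)) (fun j => hB _)
    (fun i j hij => hd (e.symm.injective.ne hij))
  have hi' : iIndepFun (fun i ω => count (Φ ω) (B i)) P := by
    have := hi.precomp e.injective
    simpa using this
  rw [(iIndepFun_iff_map_fun_eq_pi_map fun i => (h.measurable_count _ (hB i)).aemeasurable).1 hi']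
  congr 1
  funext i
  exact h.law_count _ (hB i) (hfin i)

/-- Overlapping sets are cut into disjoint cells, whose counts are independent Poisson variables
with prescribed means. The original counts are one and the same measurable function `T` of the cell
counts for both processes. -/
theorem IsPoissonProcess.map_count_eq (h : IsPoissonProcess P lam Φ)
    (h' : IsPoissonProcess P' lam Φ') {ι : Type*} [Finite ι] {B : ι → Set Plane}
    (hB : ∀ i, MeasurableSet (B i)) (hfin : ∀ i, volume (B i) ≠ ∞) :
    P.map (fun ω i => count (Φ ω) (B i)) = P'.map (fun ω i => count (Φ' ω) (B i)) := by
  classical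
  have : Fintype {b : ι → Prop // ∃ i, b i} := Fintype.ofFinite _
  let C : {b : ι → Prop // ∃ i, b i} → Set Plane := fun b => cell B b
  have hC : ∀ b, MeasurableSet (C b) := fun b => measurableSet_cell hB _
  have hCfin : ∀ b, volume (C b) ≠ ∞ := by
    rintro ⟨b, i, hi⟩
    exact measure_ne_top_of_subset (fun x hx => (hx i).2 hi) (hfin i)
  have hCd : Pairwise fun b c => Disjoint (C b) (C c) := fun b c hbc =>
    pairwise_disjoint_cell B (Subtype.coe_injective.ne hbc)
  let T : ({b : ι → Prop // ∃ i, b i} → ℕ∞) → ι → ℕ∞ := fun v i =>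
    ∑ b, if b.1 i then v b else 0
  have hT : Measurable T := by
    refine measurable_pi_lambda _ fun i => Finset.measurable_sum _ fun b _ => ?_
    split_ifs
    exacts [measurable_pi_apply b, measurable_const]
  have hcount : ∀ S i, count S (B i) = T (fun b => count S (C b)) i := fun S i =>
    count_eq_sum_cell B S i
  simp only [hcount]
  have hm := measurable_pi_lambda (fun ω b => count (Φ ω) (C b))
    fun b => h.measurable_count _ (hC b)
  have hm' := measurable_pi_lambda (fun ω b => count (Φ' ω) (C b))
    fun b => h'.measurable_count _ (hC b)
  have hmap := Measure.map_map hT hm (μ := P)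
  have hmap' := Measure.map_map hT hm' (μ := P')
  rw [h'.map_count_of_disjoint hC hCfin hCd, ← h.map_count_of_disjoint hC hCfin hCd, hmap] at hmap'
  exact hmap'

/-- The density of a Poisson process determines the joint law of all its counts. -/
theorem IsPoissonProcess.map_counts_eq (h : IsPoissonProcess P lam Φ)
    (h' : IsPoissonProcess P' lam Φ') {ι : Type*} {B : ι → Set Plane}
    (hB : ∀ i, MeasurableSet (B i)) (hfin : ∀ i, volume (B i) ≠ ∞) :
    P.map (fun ω i => count (Φ ω) (B i)) = P'.map (fun ω i => count (Φ' ω) (B i)) := by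
  have hm : Measurable fun ω i => count (Φ ω) (B i) :=
    measurable_pi_lambda _ fun i => h.measurable_count _ (hB i)
  have hm' : Measurable fun ω i => count (Φ' ω) (B i) :=
    measurable_pi_lambda _ fun i => h'.measurable_count _ (hB i)
  have hP : IsProbabilityMeasure (P.map fun ω i => count (Φ ω) (B i)) :=
    Measure.isProbabilityMeasure_map hm.aemeasurable
  -- A probability measure on a product is determined by its finite-dimensional marginals.
  refine IsProjectiveLimit.unique
    (P := fun J : Finset ι => (P.map fun ω i => count (Φ ω) (B i)).map J.restrict)
    (fun J => rfl) fun J => ?_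
  simp only
  rw [Measure.map_map (Finset.measurable_restrict J) hm,
    Measure.map_map (Finset.measurable_restrict J) hm']
  exact (h.map_count_eq h' (fun i : J => hB i) fun i => hfin i).symm

end CountLaw

/-! ### Recovering the ordered points from counts -/

section OrderStatistics

theorem eq_Iio_of_encard_eq {L : Set ℕ} (hL : IsLowerSet L) {k : ℕ} (hk : L.encard = k) :
    L = Iio k := by
  have hsub : L ⊆ Iio k := by
    intro n hn
    by_contra hkn
    have h1 : Iic k ⊆ L := fun m hm => hL (le_trans hm (not_lt.1 hkn)) hn
    have h2 := encard_le_encard h1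
    rw [hk, ← Finset.coe_Iic, encard_coe_eq_coe_finsetCard, Nat.card_Iic] at h2
    exact absurd (Nat.cast_le.1 h2) (by omega)
  refine ((finite_Iio k).subset hsub).eq_of_subset_of_encard_le hsub ?_
  rw [hk, ← Finset.coe_Iio, encard_coe_eq_coe_finsetCard, Nat.card_Iio]

theorem range_inter_closedBall (y : ℕ → Plane) (r : ℝ) :
    range y ∩ Metric.closedBall 0 r = y '' {n | ‖y n‖ ≤ r} := by
  ext x
  constructor
  · rintro ⟨⟨n, rfl⟩, hn⟩
    exact ⟨n, mem_closedBall_zero_iff.1 hn, rfl⟩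
  · rintro ⟨n, hn, rfl⟩
    exact ⟨⟨n, rfl⟩, mem_closedBall_zero_iff.2 hn⟩

/-- For points labelled by strictly increasing norm, a disc at the origin contains `k` of them if
and only if these are the first `k`. -/
theorem count_closedBall_eq_iff {y : ℕ → Plane} (hy : StrictMono fun n => ‖y n‖) (r : ℝ) (k : ℕ) :
    count (range y) (Metric.closedBall 0 r) = k ↔ ∀ n, ‖y n‖ ≤ r ↔ n < k := by
  have hinj : Function.Injective y := fun m n h => hy.injective (congrArg norm h)
  rw [count, range_inter_closedBall, hinj.encard_image]
  constructor
  · intro h n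
    have hL : IsLowerSet {n | ‖y n‖ ≤ r} := fun a b hba ha => (hy.monotone hba).trans ha
    exact Set.ext_iff.1 (eq_Iio_of_encard_eq hL h) n
  · intro h
    have h1 : {n | ‖y n‖ ≤ r} = Iio k := by ext n; exact h n
    rw [h1, ← Finset.coe_Iio, encard_coe_eq_coe_finsetCard, Nat.card_Iio]

/-- The location of the `k`-th point in terms of counts. -/
theorem mem_iff_exists_count {y : ℕ → Plane} (hy : StrictMono fun n => ‖y n‖) (k : ℕ)
    (A : Set Plane) :
    y (k + 1) ∈ A ↔ ∃ r s : ℚ,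
      count (range fun n => y (n + 1)) (Metric.closedBall 0 r) = k ∧
      count (range fun n => y (n + 1)) (Metric.closedBall 0 s) = (k + 1 : ℕ) ∧
      count (range fun n => y (n + 1))
        ((Metric.closedBall 0 s \ Metric.closedBall 0 r) ∩ A) = 1 := by
  have hz : StrictMono fun n => ‖y (n + 1)‖ := hy.comp (strictMono_id.add_const 1)
  have key : ∀ r s : ℚ, (∀ n, ‖y (n + 1)‖ ≤ r ↔ n < k) → (∀ n, ‖y (n + 1)‖ ≤ s ↔ n < k + 1) →
      (range fun n => y (n + 1)) ∩
        ((Metric.closedBall 0 s \ Metric.closedBall 0 r) ∩ A) = {y (k + 1)} ∩ A := by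
    intro r s hr hs
    ext x
    constructor
    · rintro ⟨⟨n, rfl⟩, ⟨h1, h2⟩, h3⟩
      rw [mem_closedBall_zero_iff, hs] at h1
      rw [mem_closedBall_zero_iff, hr] at h2
      obtain rfl : n = k := by omega
      exact ⟨rfl, h3⟩
    · rintro ⟨rfl, h3⟩
      refine ⟨⟨k, rfl⟩, ⟨?_, ?_⟩, h3⟩
      · rw [mem_closedBall_zero_iff, hs]; omega
      · rw [mem_closedBall_zero_iff, hr]; omega
  simp only [count_closedBall_eq_iff hz]
  constructor
  · intro hA
    -- The radii separate `y (k + 1)` from its neighbours `y k` and `y (k + 2)`. As `y 0` is not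
    -- counted, the discs contain `k` and `k + 1` points. Rational radii keep the resulting union of
    -- events countable.
    obtain ⟨r, hr1, hr2⟩ := exists_rat_btwn (hy (Nat.lt_succ_self k))
    obtain ⟨s, hs1, hs2⟩ := exists_rat_btwn (hy (Nat.lt_succ_self (k + 1)))
    have hgen : ∀ (m : ℕ) (t : ℚ), ‖y m‖ < t → (t : ℝ) < ‖y (m + 1)‖ →
        ∀ n, ‖y (n + 1)‖ ≤ t ↔ n < m := by
      intro m t h1 h2 n
      constructor
      · intro h
        have := hy.lt_iff_lt.1 (h.trans_lt h2)
        omega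
      · intro h
        exact (hy.monotone (Nat.succ_le_of_lt h)).trans h1.le
    refine ⟨r, s, hgen _ _ hr1 hr2, hgen _ _ hs1 hs2, ?_⟩
    rw [count, key r s (hgen _ _ hr1 hr2) (hgen _ _ hs1 hs2),
      inter_eq_left.2 (singleton_subset_iff.2 hA), encard_singleton]
  · rintro ⟨r, s, hr, hs, h⟩
    rw [count, key r s hr hs, encard_eq_one] at h
    obtain ⟨x, hx⟩ := h
    have : x ∈ {y (k + 1)} ∩ A := hx ▸ mem_singleton x
    exact (mem_singleton_iff.1 this.1) ▸ this.2

end OrderStatistics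

/-! ### The density determines the law of the network -/

section NetworkLaw

theorem measure_ext_of_finset_pi {ι E : Type*} [MeasurableSpace E] {μ ν : Measure (ι → E)}
    [IsProbabilityMeasure μ] [IsProbabilityMeasure ν]
    (h : ∀ (s : Finset ι) (t : ι → Set E), (∀ i, MeasurableSet (t i)) →
      μ ((s : Set ι).pi t) = ν ((s : Set ι).pi t)) : μ = ν := by
  refine ext_of_generate_finite (squareCylinders fun _ => {s : Set E | MeasurableSet s})
    generateFrom_squareCylinders.symm
    (isPiSystem_squareCylinders (fun _ => MeasurableSpace.isPiSystem_measurableSet)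
      fun _ => MeasurableSet.univ) ?_ (by simp)
  rintro _ ⟨s, t, ht, rfl⟩
  exact h s t fun i => ht i (mem_univ i)

/-- Borel sets of finite area. -/
abbrev FiniteAreaSet : Type := {B : Set Plane // MeasurableSet B ∧ volume B ≠ ∞}

/-- The closed disc around the origin. -/
def disc (r : ℝ) : FiniteAreaSet :=
  ⟨Metric.closedBall 0 r, measurableSet_closedBall, Metric.isBounded_closedBall.measure_lt_top.ne⟩

/-- The part in `A` of an annulus around the origin. -/
def annulusInter (r s : ℝ) {A : Set Plane} (hA : MeasurableSet A) : FiniteAreaSet :=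
  ⟨(Metric.closedBall 0 s \ Metric.closedBall 0 r) ∩ A,
    (measurableSet_closedBall.diff measurableSet_closedBall).inter hA,
    measure_ne_top_of_subset (inter_subset_left.trans sdiff_subset) (disc s).2.2⟩

/-- The counts for which the `n`-th base station is in `A`. -/
def countEvent {A : Set Plane} (hA : MeasurableSet A) : ℕ → Set (FiniteAreaSet → ℕ∞)
  | 0 => {_v | 0 ∈ A}
  | k + 1 => ⋃ (r : ℚ) (s : ℚ),
      {v | v (disc r) = k ∧ v (disc s) = (k + 1 : ℕ) ∧ v (annulusInter r s hA) = 1}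

theorem measurableSet_countEvent {A : Set Plane} (hA : MeasurableSet A) (n : ℕ) :
    MeasurableSet (countEvent hA n) := by
  cases n with
  | zero => exact MeasurableSet.const _
  | succ k =>
    refine MeasurableSet.iUnion fun r => MeasurableSet.iUnion fun s => ?_
    exact (measurable_pi_apply (disc r) (measurableSet_singleton _)).inter
      ((measurable_pi_apply (disc s) (measurableSet_singleton _)).inter
        (measurable_pi_apply (annulusInter r s hA) (measurableSet_singleton _)))

variable {Ω Ω' : Type*} [MeasurableSpace Ω] [MeasurableSpace Ω'] {P : Measure Ω}
  {P' : Measure Ω'} [IsProbabilityMeasure P] [IsProbabilityMeasure P'] {lam : ℝ}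
  {Y U : ℕ → Ω → Plane} {Y' U' : ℕ → Ω' → Plane}

omit [IsProbabilityMeasure P] in
-- The labelling by distance is almost surely strict, so each labelled location can be read off the
-- counts. This reduces the law of the sequence to the law of the counts.
theorem IsCellularNetwork.map_bs_pi (h : IsCellularNetwork P lam Y U) (F : Finset ℕ)
    {A : ℕ → Set Plane} (hA : ∀ n, MeasurableSet (A n)) :
    P.map (fun ω n => Y n ω) ((F : Set ℕ).pi A) =
      P.map (fun ω (B : FiniteAreaSet) => count (range fun n => Y (n + 1) ω) B)
        (⋂ n ∈ F, countEvent (hA n) n) := by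
  rw [Measure.map_apply (measurable_pi_lambda _ h.measurable_bs)
      (MeasurableSet.pi F.countable_toSet fun n _ => hA n),
    Measure.map_apply (measurable_pi_lambda _ fun B : FiniteAreaSet =>
      h.poisson_bs.measurable_count B B.2.1)
      (F.measurableSet_biInter fun n _ => measurableSet_countEvent (hA n) n)]
  refine measure_congr ?_
  filter_upwards [h.ordered_bs] with ω hω
  refine propext ?_
  simp only [preimage, mem_pi, mem_iInter, Finset.mem_coe]
  refine forall_congr' fun n => imp_congr_right fun _ => ?_
  cases n with
  | zero => rw [h.typical_bs ω]; rfl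
  | succ k =>
    rw [mem_iff_exists_count hω]
    simp only [countEvent, mem_iUnion]
    rfl

/-- The density determines the law of the base stations. -/
theorem IsCellularNetwork.map_bs_eq (h : IsCellularNetwork P lam Y U)
    (h' : IsCellularNetwork P' lam Y' U') :
    P.map (fun ω n => Y n ω) = P'.map (fun ω n => Y' n ω) := by
  have := Measure.isProbabilityMeasure_map (μ := P)
    (measurable_pi_lambda (fun ω n => Y n ω) h.measurable_bs).aemeasurable
  have := Measure.isProbabilityMeasure_map (μ := P')
    (measurable_pi_lambda (fun ω n => Y' n ω) h'.measurable_bs).aemeasurable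
  refine measure_ext_of_finset_pi fun F A hA => ?_
  rw [h.map_bs_pi F hA, h'.map_bs_pi F hA, h.poisson_bs.map_counts_eq h'.poisson_bs
    (fun B : FiniteAreaSet => B.2.1) fun B => B.2.2]

theorem measurableSet_voronoiCell (y : ℕ → Plane) (n : ℕ) : MeasurableSet (voronoiCell y n) := by
  have : voronoiCell y n = ⋂ m, {x | dist x (y n) ≤ dist x (y m)} := by ext; simp [voronoiCell]
  rw [this]
  exact MeasurableSet.iInter fun m => measurableSet_le (by fun_prop) (by fun_prop)

/-- The pairs of a configuration and a point of its `n`-th cell form a measurable set, and the areas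
of its sections depend measurably on the configuration. -/
theorem measurable_cond_voronoiCell (n : ℕ) {A : Set Plane} (hA : MeasurableSet A) :
    Measurable fun y : ℕ → Plane => (volume[|voronoiCell y n]) A := by
  have hV : MeasurableSet {z : (ℕ → Plane) × Plane | z.2 ∈ voronoiCell z.1 n} := by
    have : {z : (ℕ → Plane) × Plane | z.2 ∈ voronoiCell z.1 n} =
        ⋂ m, {z | dist z.2 (z.1 n) ≤ dist z.2 (z.1 m)} := by ext; simp [voronoiCell]
    rw [this]
    exact MeasurableSet.iInter fun m => measurableSet_le (by fun_prop) (by fun_prop)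
  have h1 : Measurable fun y : ℕ → Plane => volume (voronoiCell y n) :=
    measurable_measure_prodMk_left hV
  have h2 : Measurable fun y : ℕ → Plane => volume (voronoiCell y n ∩ A) :=
    measurable_measure_prodMk_left (hV.inter (measurable_snd hA))
  simp only [cond_apply (measurableSet_voronoiCell _ n)]
  exact h1.inv.mul h2

omit [IsProbabilityMeasure P] in
theorem IsCellularNetwork.map_mobile_pi (h : IsCellularNetwork P lam Y U) (F : Finset ℕ)
    {A : ℕ → Set Plane} (hA : ∀ n, MeasurableSet (A n)) :
    P.map (fun ω n => U n ω) ((F : Set ℕ).pi A) =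
      ∫⁻ y, ∏ n ∈ F, (volume[|voronoiCell y n]) (A n) ∂(P.map fun ω n => Y n ω) := by
  have h1 := h.uniform_mobile univ MeasurableSet.univ F A hA
  simp only [mem_univ, true_and, ofPred_true, Measure.restrict_univ] at h1
  rw [Measure.map_apply (measurable_pi_lambda _ h.measurable_mobile)
      (MeasurableSet.pi F.countable_toSet fun n _ => hA n),
    lintegral_map (Finset.measurable_prod _ fun n _ => measurable_cond_voronoiCell n (hA n))
      (measurable_pi_lambda _ h.measurable_bs), ← h1]
  rfl

/-- The density determines the law of the mobiles. -/
theorem IsCellularNetwork.map_mobile_eq (h : IsCellularNetwork P lam Y U)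
    (h' : IsCellularNetwork P' lam Y' U') :
    P.map (fun ω n => U n ω) = P'.map (fun ω n => U' n ω) := by
  have := Measure.isProbabilityMeasure_map (μ := P)
    (measurable_pi_lambda (fun ω n => U n ω) h.measurable_mobile).aemeasurable
  have := Measure.isProbabilityMeasure_map (μ := P')
    (measurable_pi_lambda (fun ω n => U' n ω) h'.measurable_mobile).aemeasurable
  refine measure_ext_of_finset_pi fun F A hA => ?_
  rw [h.map_mobile_pi F hA, h'.map_mobile_pi F hA, h.map_bs_eq h']

omit [IsProbabilityMeasure P] in
-- Conditioning on any set is absolutely continuous with respect to area, so nothing about the size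
-- of the cells is needed.
theorem IsCellularNetwork.ae_mobile_ne (h : IsCellularNetwork P lam Y U) (n : ℕ) (x : Plane) :
    ∀ᵐ ω ∂P, U n ω ≠ x := by
  have h1 := h.uniform_mobile univ MeasurableSet.univ {n} (fun _ => {x})
    fun _ => measurableSet_singleton _
  have h2 : ∀ V : Set Plane, (volume[|V]) {x} = 0 := fun V =>
    cond_absolutelyContinuous (measure_singleton x)
  rw [ae_iff]
  simpa [h2] using h1

end NetworkLaw

/-! ### Dilation of the network -/

section Scaling

theorem count_smul {c : ℝ} (hc : c ≠ 0) (y : ℕ → Plane) (B : Set Plane) :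
    count (range fun n => c • y n) B = count (range y) ((fun x => c • x) ⁻¹' B) := by
  have h : (range fun n => c • y n) ∩ B =
      (fun x => c • x) '' (range y ∩ (fun x => c • x) ⁻¹' B) := by
    rw [image_inter_preimage, ← range_comp]
    rfl
  rw [count, h, (smul_right_injective Plane hc).encard_image, count]

theorem volume_preimage_smul {c : ℝ} (hc : 0 < c) (B : Set Plane) :
    volume ((fun x : Plane => c • x) ⁻¹' B) = ENNReal.ofReal (c ^ 2)⁻¹ * volume B := by
  rw [Measure.addHaar_preimage_smul _ hc.ne', finrank_euclideanSpace_fin,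
    abs_of_pos (by positivity)]

theorem preimage_smul_voronoiCell {c : ℝ} (hc : 0 < c) (y : ℕ → Plane) (n : ℕ) :
    (fun x => c • x) ⁻¹' voronoiCell (fun m => c • y m) n = voronoiCell y n := by
  ext x
  simp only [voronoiCell, preimage, mem_ofPred_eq, dist_smul₀,
    mul_le_mul_iff_right₀ (norm_pos_iff.2 hc.ne')]

/-- Cells scale with their nuclei, and the area factor cancels between numerator and denominator. It
is nonzero and finite, so this also covers cells of zero or infinite area. -/
theorem cond_voronoiCell_smul {c : ℝ} (hc : 0 < c) (y : ℕ → Plane) (n : ℕ) (A : Set Plane) :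
    (volume[|voronoiCell (fun m => c • y m) n]) A =
      (volume[|voronoiCell y n]) ((fun x => c • x) ⁻¹' A) := by
  have hk : ENNReal.ofReal (c ^ 2)⁻¹ ≠ 0 := (ENNReal.ofReal_pos.2 (by positivity)).ne'
  rw [cond_apply (measurableSet_voronoiCell _ _), cond_apply (measurableSet_voronoiCell _ _),
    ← preimage_smul_voronoiCell hc y n, ← preimage_inter, volume_preimage_smul hc,
    volume_preimage_smul hc, ENNReal.mul_inv (Or.inl hk) (Or.inl ENNReal.ofReal_ne_top),
    mul_mul_mul_comm, ENNReal.inv_mul_cancel hk ENNReal.ofReal_ne_top, one_mul]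

variable {Ω : Type*} [MeasurableSpace Ω] {P : Measure Ω} {lam : ℝ} {Y U : ℕ → Ω → Plane}

theorem IsPoissonProcess.smul {y : ℕ → Ω → Plane}
    (h : IsPoissonProcess P lam fun ω => range fun n => y n ω) {c : ℝ} (hc : 0 < c) :
    IsPoissonProcess P (lam / c ^ 2) fun ω => range fun n => c • y n ω := by
  have hm : Measurable fun x : Plane => c • x := measurable_const_smul c
  constructor
  · intro B hB
    simp only [count_smul hc.ne']
    exact h.measurable_count _ (hm hB)
  · intro B hB hfin
    simp only [count_smul hc.ne']
    rw [h.law_count _ (hm hB), volume_preimage_smul hc, ENNReal.toReal_mul,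
      ENNReal.toReal_ofReal (by positivity), ← mul_assoc, div_eq_mul_inv]
    rw [volume_preimage_smul hc]
    exact ENNReal.mul_ne_top ENNReal.ofReal_ne_top hfin
  · intro n B hB hd
    simp only [count_smul hc.ne']
    exact h.indep_count n _ (fun i => hm (hB i)) fun i j hij => (hd hij).preimage _

/-- A dilation of a cellular network is a cellular network. -/
theorem IsCellularNetwork.smul (h : IsCellularNetwork P lam Y U) {c : ℝ} (hc : 0 < c) :
    IsCellularNetwork P (lam / c ^ 2) (fun n ω => c • Y n ω) fun n ω => c • U n ω := by
  have hm : Measurable fun x : Plane => c • x := measurable_const_smul c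
  constructor
  · exact fun n => (h.measurable_bs n).const_smul c
  · exact fun n => (h.measurable_mobile n).const_smul c
  · intro ω
    simp [h.typical_bs ω]
  · exact h.poisson_bs.smul hc
  · filter_upwards [h.ordered_bs] with ω hω m n hmn
    simp only [norm_smul]
    exact mul_lt_mul_of_pos_left (hω hmn) (norm_pos_iff.2 hc.ne')
  · intro S hS F A hA
    have hS' : MeasurableSet ((fun (y : ℕ → Plane) n => c • y n) ⁻¹' S) :=
      (measurable_pi_lambda _ fun n => hm.comp (measurable_pi_apply n)) hS
    have h1 := h.uniform_mobile _ hS' F (fun n => (fun x => c • x) ⁻¹' A n) fun n => hm (hA n)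
    simp only [cond_voronoiCell_smul hc]
    exact h1

end Scaling

/-! ### Outage as an exceedance event at density 1 -/

section Outage

theorem cancelled_smul {c : ℝ} (hc : 0 < c) (K : ℕ) (u : ℕ → Plane) :
    cancelled K (fun n => c • u n) = cancelled K u := by
  simp only [cancelled, norm_smul, mul_lt_mul_iff_right₀ (norm_pos_iff.2 hc.ne')]

theorem enorm_smul_rpow_neg {c : ℝ} (hc : 0 < c) (α : ℝ) (x : Plane) :
    ‖c • x‖ₑ ^ (-α) = ENNReal.ofReal (c ^ (-α)) * ‖x‖ₑ ^ (-α) := by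
  rw [enorm_smul, ENNReal.mul_rpow_of_ne_top enorm_ne_top enorm_ne_top,
    Real.enorm_of_nonneg hc.le, ENNReal.ofReal_rpow_of_pos hc]

theorem interference_smul {c : ℝ} (hc : 0 < c) (α p : ℝ) (K : ℕ) (u : ℕ → Plane) :
    interference α p K (fun n => c • u n) =
      ENNReal.ofReal (c ^ (-α)) * interference α p K u := by
  rw [interference, interference, ← ENNReal.tsum_mul_left]
  refine tsum_congr fun n => ?_
  rw [cancelled_smul hc, enorm_smul_rpow_neg hc, mul_ite, mul_zero, mul_left_comm]

theorem interference_eq_mul (α p : ℝ) (K : ℕ) (u : ℕ → Plane) :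
    interference α p K u = ENNReal.ofReal p * interference α 1 K u := by
  rw [interference, interference, ← ENNReal.tsum_mul_left]
  refine tsum_congr fun n => ?_
  rw [mul_ite, mul_zero, ENNReal.ofReal_one, one_mul]

theorem measurable_interference (α p : ℝ) (K : ℕ) : Measurable (interference α p K) := by
  classical
  refine Measurable.tsum fun n => Measurable.ite ?_ ?_ measurable_const
  · refine (MeasurableSet.const _).inter (MeasurableSet.compl ((MeasurableSet.const _).inter ?_))
    -- Cancellation of label `n` depends on `u` only through the cardinality of this random set of
    -- labels.
    have h : Measurable fun u : ℕ → Plane => {m | m ≠ 0 ∧ ‖u m‖ < ‖u n‖} := by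
      refine measurable_set_iff.2 fun m => ?_
      exact ((MeasurableSet.const (m ≠ 0)).inter
        (measurableSet_lt (f := fun u : ℕ → Plane => ‖u m‖) (g := fun u => ‖u n‖)
          (by fun_prop) (by fun_prop))).mem
    exact (measurable_encard.comp h) (MeasurableSet.of_discrete (s := Iio (K : ℕ∞)))
  · exact (((measurable_pi_apply n).enorm).pow_const _).const_mul _

variable {Ω : Type*} [MeasurableSpace Ω] {P : Measure Ω} [IsProbabilityMeasure P]
  {lam : ℝ} {Y U Y' U' : ℕ → Ω → Plane}

/-- This transfers the defining property of `μ`, known for one network of density 1, to the dilated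
network. -/
theorem IsCellularNetwork.exceedProb_eq (h : IsCellularNetwork P lam Y U)
    (h' : IsCellularNetwork P lam Y' U') (α θ μ : ℝ) (K : ℕ) :
    exceedProb P U α θ μ K = exceedProb P U' α θ μ K := by
  have hE : MeasurableSet {u : ℕ → Plane | ENNReal.ofReal θ⁻¹ * ‖u 0‖ₑ ^ (-α) <
      interference α 1 K u + ENNReal.ofReal μ} :=
    measurableSet_lt ((((measurable_pi_apply 0).enorm).pow_const _).const_mul _)
      ((measurable_interference α 1 K).add_const _)
  have h1 := congrArg (fun m => m {u : ℕ → Plane | ENNReal.ofReal θ⁻¹ * ‖u 0‖ₑ ^ (-α) <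
      interference α 1 K u + ENNReal.ofReal μ}) (h.map_mobile_eq h')
  rwa [Measure.map_apply (measurable_pi_lambda _ h.measurable_mobile) hE,
    Measure.map_apply (measurable_pi_lambda _ h'.measurable_mobile) hE] at h1

/-- Multiplying the exceedance inequality by `θ * p * c ^ α` yields the outage inequality with its
denominator cleared; `hpc` turns the constant `μ` into the noise variance. Clearing is legitimate
since the noise is positive and the signal finite; the interference `I` may be infinite. -/
theorem outage_iff_exceed {c α θ σ p μ : ℝ} (hc : 0 < c) (hθ : 0 < θ) (hσ : 0 < σ) (hp : 0 < p)
    (hpc : p * c ^ α * μ = σ ^ 2) {a I : ℝ≥0∞} (ha : a ≠ ⊤) :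
    ENNReal.ofReal p * a / (ENNReal.ofReal p * I + ENNReal.ofReal (σ ^ 2)) < ENNReal.ofReal θ ↔
      ENNReal.ofReal θ⁻¹ * (ENNReal.ofReal (c ^ (-α)) * a) <
        ENNReal.ofReal (c ^ (-α)) * I + ENNReal.ofReal μ := by
  have hcα : 0 < c ^ α := Real.rpow_pos_of_pos hc α
  have hk : 0 < θ * p * c ^ α := by positivity
  rw [ENNReal.div_lt_iff (Or.inl (by simp [hσ.ne']))
    (Or.inr (ENNReal.mul_ne_top ENNReal.ofReal_ne_top ha)),
    ← ENNReal.mul_lt_mul_iff_right (b := ENNReal.ofReal θ⁻¹ * (ENNReal.ofReal (c ^ (-α)) * a))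
      (ENNReal.ofReal_pos.2 hk).ne' ENNReal.ofReal_ne_top]
  have e1 : ENNReal.ofReal (θ * p * c ^ α) *
      (ENNReal.ofReal θ⁻¹ * (ENNReal.ofReal (c ^ (-α)) * a)) = ENNReal.ofReal p * a := by
    rw [← mul_assoc, ← mul_assoc, ← ENNReal.ofReal_mul hk.le,
      ← ENNReal.ofReal_mul (by positivity), Real.rpow_neg hc.le]
    congr 2
    field_simp
  have e2 : ENNReal.ofReal (θ * p * c ^ α) *
      (ENNReal.ofReal (c ^ (-α)) * I + ENNReal.ofReal μ) =
      ENNReal.ofReal θ * (ENNReal.ofReal p * I + ENNReal.ofReal (σ ^ 2)) := by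
    have f1 : ENNReal.ofReal (θ * p * c ^ α) * ENNReal.ofReal (c ^ (-α)) =
        ENNReal.ofReal θ * ENNReal.ofReal p := by
      rw [← ENNReal.ofReal_mul hk.le, ← ENNReal.ofReal_mul hθ.le, Real.rpow_neg hc.le]
      congr 1
      field_simp
    have f2 : ENNReal.ofReal (θ * p * c ^ α) * ENNReal.ofReal μ =
        ENNReal.ofReal θ * ENNReal.ofReal (σ ^ 2) := by
      rw [← ENNReal.ofReal_mul hk.le, ← ENNReal.ofReal_mul hθ.le, ← hpc]
      ring_nf
    rw [mul_add, mul_add, ← mul_assoc, f1, f2, mul_assoc]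
  rw [e1, e2]

/-- The outage probability with the critical transmission power. -/
theorem IsCellularNetwork.outageProb_eq_exceedProb (h : IsCellularNetwork P lam Y U)
    (h' : IsCellularNetwork P 1 Y' U') (hlam : 0 < lam) {α θ σ p μ : ℝ} (hθ : 0 < θ)
    (hσ : 0 < σ) (hp : 0 < p) (hpc : p * lam ^ (α / 2) * μ = σ ^ 2) (K : ℕ) :
    outageProb P U α θ σ p K = exceedProb P U' α θ μ K := by
  have hc : 0 < √lam := Real.sqrt_pos.2 hlam
  have hV := h.smul hc
  rw [Real.sq_sqrt hlam.le, div_self hlam.ne'] at hV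
  rw [← hV.exceedProb_eq h']
  refine measure_congr ?_
  filter_upwards [h.ae_mobile_ne 0 0] with ω hω
  refine propext ?_
  have ha : ‖U 0 ω‖ₑ ^ (-α) ≠ ⊤ := by
    simp [ENNReal.rpow_eq_top_iff, hω]
  have hpc' : p * √lam ^ α * μ = σ ^ 2 := by
    rw [← hpc, Real.sqrt_eq_rpow, ← Real.rpow_mul hlam.le, one_div_mul_eq_div]
  have := outage_iff_exceed (I := interference α 1 K fun n => U n ω) hc hθ hσ hp hpc' ha
  rw [← interference_smul hc, ← enorm_smul_rpow_neg hc, ← interference_eq_mul] at this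
  exact this

end Outage

/-! ### Power guaranteed by one beacon nearby -/

section ReceivedPower

theorem pathGain_anti {β ν : ℝ} (hβ : 0 ≤ β) (hν : 0 < ν) {u T : Plane} {r : ℝ}
    (hT : dist T u ≤ r) : ENNReal.ofReal (max r ν ^ (-β)) ≤ pathGain β ν u T :=
  ENNReal.ofReal_le_ofReal (Real.rpow_le_rpow_of_nonpos (lt_max_of_lt_right hν)
    (max_le_max_right ν hT) (neg_nonpos.2 hβ))

theorem isotropicPower_ge {β ν q : ℝ} (hβ : 0 ≤ β) (hν : 0 < ν) {S : Set Plane} {u : Plane} {r : ℝ}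
    (hS : (S ∩ Metric.closedBall u r).Nonempty) :
    ENNReal.ofReal q * ENNReal.ofReal (max r ν ^ (-β)) ≤ isotropicPower β ν q S u := by
  obtain ⟨T, hTS, hT⟩ := hS
  refine mul_le_mul_right ?_ _
  exact (pathGain_anti hβ hν hT).trans
    (ENNReal.le_tsum (f := fun T : S => pathGain β ν u T) ⟨T, hTS⟩)

/-- Finiteness in the disc provides a minimiser of the distance there, which is then a minimiser
over all of `S`. Hence the choice in `nearestPoint` is a genuine nearest point. -/
theorem dist_nearestPoint_le {S : Set Plane} {u : Plane} {r : ℝ}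
    (hfin : (S ∩ Metric.closedBall u r).Finite) (hS : (S ∩ Metric.closedBall u r).Nonempty) :
    dist (nearestPoint S u) u ≤ r := by
  obtain ⟨T, ⟨hTS, hT⟩, hmin⟩ := exists_min_image _ (fun T => dist T u) hfin hS
  have hex : ∃ T, T ∈ S ∧ ∀ T' ∈ S, dist T u ≤ dist T' u := by
    refine ⟨T, hTS, fun T' hT' => ?_⟩
    by_cases h : dist T' u ≤ r
    · exact hmin T' ⟨hT', h⟩
    · exact (Metric.mem_closedBall.1 hT).trans (not_le.1 h).le
  exact ((Classical.epsilon_spec hex).2 T hTS).trans hT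

theorem directedPower_ge {β ν zm zs q : ℝ} (hβ : 0 ≤ β) (hν : 0 < ν) {S : Set Plane} {u : Plane}
    {r : ℝ} (hfin : (S ∩ Metric.closedBall u r).Finite)
    (hS : (S ∩ Metric.closedBall u r).Nonempty) :
    ENNReal.ofReal (zm * q) * ENNReal.ofReal (max r ν ^ (-β)) ≤
      directedPower β ν zm zs q S u :=
  (mul_le_mul_right (pathGain_anti hβ hν (dist_nearestPoint_le hfin hS)) _).trans le_self_add

end ReceivedPower

/-! ### Choice of the transmission power and conclusion -/

section Feasibility

/-- The outage equation fixes `p = σ ^ 2 / (μ * a ^ (α / 2))`, and `p = w * r ^ (-β)` then fixes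
`r`. Raising `h2` to the power `α / 2` gives `ν ^ β ≤ r ^ β`, while `h1` is the void condition after
`r ^ 2` is expanded. -/
theorem exists_transmission_power {α β ν σ δ μ w a b : ℝ} (hα : 0 < α) (hβ : 0 < β) (hν : 0 < ν)
    (hσ : 0 < σ) (hδ₀ : 0 < δ) (hδ₁ : δ < 1) (hμ : 0 < μ) (hw : 0 ≤ w) (ha : 0 ≤ a) (hb : 0 ≤ b)
    (h1 : Real.log (1 / δ) / Real.pi * (σ ^ 2 / μ) ^ (2 / β) ≤ w ^ (2 / β) * b * a ^ (α / β))
    (h2 : (σ ^ 2 * ν ^ β / μ) ^ (2 / α) ≤ w ^ (2 / α) * a) :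
    0 < a ∧ 0 < b ∧ ∃ p r : ℝ, 0 < p ∧ 0 < r ∧ p * a ^ (α / 2) * μ = σ ^ 2 ∧ ν ≤ r ∧
      p = w * r ^ (-β) ∧ Real.log (1 / δ) ≤ b * (Real.pi * r ^ 2) := by
  have hνβ : 0 < ν ^ β := Real.rpow_pos_of_pos hν β
  have hσν : 0 < σ ^ 2 * ν ^ β / μ := by positivity
  -- The left sides of `h1` and `h2` are positive, which excludes the boundary of the quadrant and
  -- also `w = 0`.
  have h2' : 0 < w ^ (2 / α) * a := (Real.rpow_pos_of_pos hσν _).trans_le h2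
  have ha' : 0 < a := ha.lt_of_ne fun h => by simp [← h] at h2'
  have hw' : 0 < w := hw.lt_of_ne fun h => by
    rw [← h, Real.zero_rpow (by positivity), zero_mul] at h2'
    exact h2'.false
  have hlog : 0 < Real.log (1 / δ) := Real.log_pos (by rw [lt_div_iff₀ hδ₀]; linarith)
  have hb' : 0 < b := hb.lt_of_ne fun h => by
    rw [← h, mul_zero, zero_mul] at h1
    have : 0 < Real.log (1 / δ) / Real.pi * (σ ^ 2 / μ) ^ (2 / β) := by
      have := Real.pi_pos
      positivity
    exact (this.trans_le h1).false
  have haα : 0 < a ^ (α / 2) := Real.rpow_pos_of_pos ha' _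
  have hg : 0 < w * a ^ (α / 2) / (σ ^ 2 / μ) := by positivity
  refine ⟨ha', hb', σ ^ 2 / μ / a ^ (α / 2), (w * a ^ (α / 2) / (σ ^ 2 / μ)) ^ (1 / β),
    by positivity, Real.rpow_pos_of_pos hg _, by field_simp, ?_, ?_, ?_⟩
  · have h3 : σ ^ 2 * ν ^ β / μ ≤ w * a ^ (α / 2) := by
      have := Real.rpow_le_rpow (Real.rpow_nonneg hσν.le _) h2 (half_pos hα).le
      rwa [Real.mul_rpow (Real.rpow_nonneg hw _) ha, ← Real.rpow_mul hσν.le, ← Real.rpow_mul hw,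
        div_mul_div_cancel₀ hα.ne', div_self two_ne_zero, Real.rpow_one, Real.rpow_one] at this
    have h4 : ν ^ β ≤ w * a ^ (α / 2) / (σ ^ 2 / μ) := by
      rw [le_div_iff₀ (by positivity)]
      calc ν ^ β * (σ ^ 2 / μ) = σ ^ 2 * ν ^ β / μ := by ring
        _ ≤ _ := h3
    calc ν = (ν ^ β) ^ (1 / β) := by
          rw [← Real.rpow_mul hν.le, mul_one_div_cancel hβ.ne', Real.rpow_one]
      _ ≤ _ := Real.rpow_le_rpow hνβ.le h4 (by positivity)
  · rw [← Real.rpow_mul hg.le, mul_neg, one_div_mul_cancel hβ.ne', Real.rpow_neg_one]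
    field_simp
  · have h3 : ((w * a ^ (α / 2) / (σ ^ 2 / μ)) ^ (1 / β)) ^ 2 =
        w ^ (2 / β) * a ^ (α / β) / (σ ^ 2 / μ) ^ (2 / β) := by
      have e1 : 1 / β * ((2 : ℕ) : ℝ) = 2 / β := by push_cast; ring
      have e2 : α / 2 * (2 / β) = α / β := by field_simp
      rw [← Real.rpow_natCast, ← Real.rpow_mul hg.le, e1,
        Real.div_rpow (by positivity) (by positivity),
        Real.mul_rpow hw haα.le, ← Real.rpow_mul ha, e2]
    have hs : 0 < (σ ^ 2 / μ) ^ (2 / β) := Real.rpow_pos_of_pos (by positivity) _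
    rw [h3]
    calc Real.log (1 / δ) = Real.log (1 / δ) / Real.pi * (σ ^ 2 / μ) ^ (2 / β) *
          (Real.pi / (σ ^ 2 / μ) ^ (2 / β)) := by
            have := Real.pi_pos.ne'
            have := hs.ne'
            field_simp
      _ ≤ w ^ (2 / β) * b * a ^ (α / β) * (Real.pi / (σ ^ 2 / μ) ^ (2 / β)) :=
          mul_le_mul_of_nonneg_right h1 (div_nonneg Real.pi_pos.le hs.le)
      _ = _ := by ring

variable {Ω : Type*} [MeasurableSpace Ω] {P : Measure Ω} [IsProbabilityMeasure P]

/-- If a beacon within distance `r` guarantees the power `p`, then the received power is below `p`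
with probability at most the void probability of a disc of radius `r`. -/
theorem IsPoissonProcess.measure_power_lt_le {lam : ℝ} {Φ : Ω → Set Plane}
    (h : IsPoissonProcess P lam Φ) (hlam : 0 ≤ lam) {X : Ω → Plane} (hX : Measurable X)
    (hind : Indep (pointSigma Φ) (MeasurableSpace.comap X inferInstance) P)
    {rx : Set Plane → Plane → ℝ≥0∞} {r δ : ℝ} {p : ℝ≥0∞} (hr : 0 < r) (hδ : 0 < δ)
    (hrx : ∀ S u, (S ∩ Metric.closedBall u r).Finite → (S ∩ Metric.closedBall u r).Nonempty →
      p ≤ rx S u)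
    (hvoid : Real.log (1 / δ) ≤ lam * (Real.pi * r ^ 2)) :
    P {ω | rx (Φ ω) (X ω) < p} ≤ ENNReal.ofReal δ := by
  calc P {ω | rx (Φ ω) (X ω) < p} ≤ P {ω | Φ ω ∩ Metric.closedBall (X ω) r = ∅} := by
        -- The inclusion holds only almost surely, because `hrx` needs finitely many beacons in the
        -- disc.
        refine measure_mono_ae ?_
        filter_upwards [h.ae_finite_inter_closedBall] with ω hω hlt
        by_contra hne
        exact (hrx _ _ (hω _ _) (nonempty_iff_ne_empty.2 hne)).not_gt hlt
    _ ≤ _ := h.measure_closedBall_eq_empty_le hlam hX hind hr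
    _ ≤ ENNReal.ofReal δ := by
        refine ENNReal.ofReal_le_ofReal ?_
        rw [one_div, Real.log_inv] at hvoid
        calc Real.exp (-(lam * (Real.pi * r ^ 2))) ≤ Real.exp (Real.log δ) :=
              Real.exp_le_exp.2 (by linarith)
          _ = δ := Real.exp_log hδ

/-- Both transfer modes are covered at once: `w` is the power radiated towards the mobile by the
beacon that is relied on, and `hrx` is all that is used about `rx`. -/
theorem IsHybridNetwork.mem_feasibilityRegion {Y U : ℝ → ℕ → Ω → Plane} {Ψ : ℝ → Ω → Set Plane}
    (hnet : IsHybridNetwork P Y U Ψ) {α β ν θ σ ε δ μ w : ℝ} {K : ℕ}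
    (hα : 0 < α) (hβ : 0 < β) (hν : 0 < ν) (hθ : 0 < θ) (hσ : 0 < σ)
    (hδ₀ : 0 < δ) (hδ₁ : δ < 1) (hw : 0 ≤ w) (hμ₀ : 0 < μ)
    (hμ : exceedProb P (U 1) α θ μ K = ENNReal.ofReal ε) {rx : Set Plane → Plane → ℝ≥0∞}
    (hrx : ∀ S u r, (S ∩ Metric.closedBall u r).Finite → (S ∩ Metric.closedBall u r).Nonempty →
      ENNReal.ofReal w * ENNReal.ofReal (max r ν ^ (-β)) ≤ rx S u)
    {x : ℝ × ℝ} (ha : 0 ≤ x.1) (hb : 0 ≤ x.2)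
    (h1 : Real.log (1 / δ) / Real.pi * (σ ^ 2 / μ) ^ (2 / β) ≤
      w ^ (2 / β) * x.2 * x.1 ^ (α / β))
    (h2 : (σ ^ 2 * ν ^ β / μ) ^ (2 / α) ≤ w ^ (2 / α) * x.1) :
    x ∈ feasibilityRegion P U Ψ α θ σ K ε δ rx := by
  obtain ⟨ha', hb', p, r, hp, hr, hpc, hνr, hpr, hvoid⟩ :=
    exists_transmission_power hα hβ hν hσ hδ₀ hδ₁ hμ₀ hw ha hb h1 h2
  have hcell := hnet.cellular x.1 ha'
  refine ⟨ha', hb', p, hp, ?_, fun n => ?_⟩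
  · rw [hcell.outageProb_eq_exceedProb (hnet.cellular 1 one_pos) ha' hθ hσ hp hpc, hμ]
  · refine (hnet.poisson_pb x.2 hb').measure_power_lt_le hb (hcell.measurable_mobile n) ?_ hr hδ₀
      (fun S u hfin hne => ?_) hvoid
    · refine indep_of_indep_of_le_right (hnet.indep_pb x.1 x.2 ha' hb') ?_
      rintro _ ⟨A, hA, rfl⟩
      exact ⟨(fun z : ℕ → Plane × Plane => (z n).2) ⁻¹' A,
        (measurable_snd.comp (measurable_pi_apply n)) hA, rfl⟩
    · have := hrx S u r hfin hne
      rwa [max_eq_left hνr, ← ENNReal.ofReal_mul hw, ← hpr] at this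

end Feasibility

end MPT
theorem proposition5
    {Ω : Type*} [MeasurableSpace Ω] (P : Measure Ω) [IsProbabilityMeasure P]
    (Y U : ℝ → ℕ → Ω → MPT.Plane) (Ψ : ℝ → Ω → Set MPT.Plane)
    (hnet : MPT.IsHybridNetwork P Y U Ψ)
    (α β ν θ σ ε δ μ q zm zs : ℝ) (K : ℕ)
    (hα : 2 < α) (hβ : 2 < β) (hν : 1 < ν) (hθ : 0 < θ) (hσ : 0 < σ)
    (hε₀ : 0 < ε) (hε₁ : ε < 1) (hδ₀ : 0 < δ) (hδ₁ : δ < 1)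
    (hq : 0 ≤ q) (hzm : 0 < zm) (hzs : 0 < zs)
    (hμ₀ : 0 < μ) (hμ : MPT.exceedProb P (U 1) α θ μ K = ENNReal.ofReal ε) :
    {x : ℝ × ℝ | 0 ≤ x.1 ∧ 0 ≤ x.2 ∧
        Real.log (1 / δ) / Real.pi * (σ ^ 2 / μ) ^ (2 / β)
          ≤ q ^ (2 / β) * x.2 * x.1 ^ (α / β) ∧
        (σ ^ 2 * ν ^ β / μ) ^ (2 / α) ≤ q ^ (2 / α) * x.1}
      ⊆ MPT.feasibilityRegion P U Ψ α θ σ K ε δ (MPT.isotropicPower β ν q) ∧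
    {x : ℝ × ℝ | 0 ≤ x.1 ∧ 0 ≤ x.2 ∧
        Real.log (1 / δ) / Real.pi * (σ ^ 2 / μ) ^ (2 / β)
          ≤ (zm * q) ^ (2 / β) * x.2 * x.1 ^ (α / β) ∧
        (σ ^ 2 * ν ^ β / μ) ^ (2 / α) ≤ (zm * q) ^ (2 / α) * x.1}
      ⊆ MPT.feasibilityRegion P U Ψ α θ σ K ε δ (MPT.directedPower β ν zm zs q) := by
  have hα' : 0 < α := by linarith
  have hβ' : 0 < β := by linarith
  have hν' : 0 < ν := by linarith
  constructor
  · rintro x ⟨ha, hb, h1, h2⟩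
    exact hnet.mem_feasibilityRegion hα' hβ' hν' hθ hσ hδ₀ hδ₁ hq hμ₀ hμ
      (fun S u r _ hne => MPT.isotropicPower_ge hβ'.le hν' hne) ha hb h1 h2
  · rintro x ⟨ha, hb, h1, h2⟩
    exact hnet.mem_feasibilityRegion hα' hβ' hν' hθ hσ hδ₀ hδ₁ (mul_nonneg hzm.le hq) hμ₀ hμ
      (fun S u r hfin hne => MPT.directedPower_ge hβ'.le hν' hfin hne) ha hb h1 h2
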